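/- Let $(X,\mathcal B,\mu)$ and $(Y,\mathcal C,\nu)$ be standard Borel probability spaces, let $T$ be an automorphism of $(X,\mathcal B,\mu)$, let $G$ be a second countable locally compact (Hausdorff) Abelian group with character group $\widehat G$, let $\varphi:X\to G$ be measurable, and let $\mathcal S=(S_g)_{g\in G}$ be a measurable measure-preserving action of $G$ on $(Y,\mathcal C,\nu)$. Define $$T_{\varphi,\mathcal S}(x,y)=(Tx,S_{\varphi(x)}(y))\quad\text{on }(X\times Y,\mathcal B\otimes\mathcal C,\mu\otimes\nu),$$ $$\Sigma_\varphi=\{\chi\in\widehat G:\ \chi\circ\varphi=c\cdot\xi/(\xi\circ T)\ \mu\text{-a.e. for some constant } c\in\mathbb T\text{ and some measurable }\xi:X\to\mathbb T\},$$ where $\mathbb T=\{z\in\mathbb C:|z|=1\}$. For $f\in L^2(Y,\nu)$ the spectral measure $\sigma_{f,\mathcal S}$ is the finite Borel measure on $\widehat G$ with $\int_{\widehat G}\chi(g)\,d\sigma_{f,\mathcal S}(\chi)=\int_Y f\circ S_g\cdot\overline f\,d\nu$ for all $g\in G$, and $\sigma_{\mathcal S}$ denotes the maximal spectral type of $\mathcal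 S$ on $L^2_0(Y,\nu)=\{f\in L^2(Y,\nu):\int_Y f\,d\nu=0\}$, i.e. a measure such that $\sigma_{f,\mathcal S}\ll\sigma_{\mathcal S}$ for every $f\in L^2_0(Y,\nu)$ and that is equivalent to $\sigma_{f_0,\mathcal S}$ for some $f_0\in L^2_0(Y,\nu)$. An automorphism $R$ of a probability space is called mildly mixing if it has no non-trivial rigid factor, where a factor is a sub-$\sigma$-algebra $\mathcal A$ with $R^{-1}\mathcal A=\mathcal A$ modulo null sets, it is non-trivial if it contains a set of measure strictly between $0$ and $1$, and it is rigid if there is a sequence of integers $q_n\to\infty$ such that $f\circ R^{q_n}\to f$ in $L^2$ for every $f\in L^2(\mathcal A)$. If $T$ is mildly mixing and $\sigma_{\mathcal S}(\Sigma_\varphi)=0$, then the automorphism $T_{\varphi,\mathcal S}$ is mildly mixing. -/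

import Mathlib

open MeasureTheory Filter Topology
open scoped ENNReal ComplexConjugate

namespace RokhlinExtension

/-- The character group carries its Borel `σ`-algebra. -/
noncomputable instance instMeasurableSpaceDual (G : Type*) [CommGroup G] [TopologicalSpace G] :
    MeasurableSpace (PontryaginDual G) :=
  borel (PontryaginDual G)

instance instBorelSpaceDual (G : Type*) [CommGroup G] [TopologicalSpace G] :
    BorelSpace (PontryaginDual G) :=
  ⟨rfl⟩

section Automorphisms

variable {X : Type*}

/-- `T` is an automorphism of `(X, μ)`: it preserves `μ` and is invertible modulo null sets. -/
structure IsAutomorphism [MeasurableSpace X] (T : X → X) (μ : Measure X) : Prop where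
  measurePreserving : MeasurePreserving T μ μ
  exists_inverse : ∃ R : X → X, Measurable R ∧
    (∀ᵐ x ∂μ, R (T x) = x) ∧ (∀ᵐ x ∂μ, T (R x) = x)

/-- A factor of the automorphism `T`: a sub-`σ`-algebra `𝒜` with `T⁻¹𝒜 = 𝒜` modulo null sets. -/
structure IsFactor (𝒜 : MeasurableSpace X) [mX : MeasurableSpace X] (T : X → X) (μ : Measure X) : Prop where
  le : 𝒜 ≤ mX
  preimage_mem : ∀ A, MeasurableSet[𝒜] A → ∃ B, MeasurableSet[𝒜] B ∧ T ⁻¹' A =ᵐ[μ] B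
  exists_preimage : ∀ A, MeasurableSet[𝒜] A → ∃ B, MeasurableSet[𝒜] B ∧ T ⁻¹' B =ᵐ[μ] A

/-- The factor `𝒜` of `T` is rigid: along some sequence `q n → ∞` one has `f ∘ T^(q n) → f` in `L²`
for every `f ∈ L²(𝒜)`. -/
def IsRigidFactor (𝒜 : MeasurableSpace X) [MeasurableSpace X] (T : X → X) (μ : Measure X) : Prop :=
  IsFactor 𝒜 T μ ∧ ∃ q : ℕ → ℕ, Tendsto q atTop atTop ∧
    ∀ f : X → ℂ, StronglyMeasurable[𝒜] f → MemLp f 2 μ →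
      Tendsto (fun n => eLpNorm (fun x => f (T^[q n] x) - f x) 2 μ) atTop (𝓝 0)

/-- `𝒜` consists of null and co-null sets only. -/
def IsTrivialMod (𝒜 : MeasurableSpace X) [MeasurableSpace X] (μ : Measure X) : Prop :=
  ∀ A, MeasurableSet[𝒜] A → μ A = 0 ∨ μ Aᶜ = 0

/-- `T` is a mildly mixing automorphism of `(X, μ)`: it has no non-trivial rigid factor. -/
structure MildlyMixing [mX : MeasurableSpace X] (T : X → X) (μ : Measure X) : Prop where
  isAutomorphism : IsAutomorphism T μ
  trivial_of_rigid : ∀ 𝒜 : MeasurableSpace X, @IsRigidFactor X 𝒜 mX T μ → @IsTrivialMod X 𝒜 mX μ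

end Automorphisms

section Actions

variable {G : Type*} [CommGroup G] [TopologicalSpace G] [MeasurableSpace G]
variable {Y : Type*} [MeasurableSpace Y]

/-- `S` is a measurable measure-preserving action of `G` on `(Y, ν)`. Automorphisms are identified
when they agree `ν`-almost everywhere, so the homomorphism property is asked for each pair of
group elements modulo null sets. -/
structure IsMeasurableAction (S : G → Y → Y) (ν : Measure Y) : Prop where
  measurable : Measurable (fun p : G × Y => S p.1 p.2)
  measurePreserving : ∀ g, MeasurePreserving (S g) ν ν
  one : ∀ᵐ y ∂ν, S 1 y = y
  mul : ∀ g h, ∀ᵐ y ∂ν, S (g * h) y = S g (S h y)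

/-- `τ` is the spectral measure of `f` under the action `S`: the finite Borel measure on the
character group with `∫ χ(g) dτ(χ) = ∫ (f ∘ S_g) · conj f dν` for all `g`. -/
structure IsSpectralMeasure (S : G → Y → Y) (ν : Measure Y) (f : Y → ℂ)
    (τ : Measure (PontryaginDual G)) : Prop where
  finite : IsFiniteMeasure τ
  fourier : ∀ g : G, ∫ χ : PontryaginDual G, (χ g : ℂ) ∂τ = ∫ y, f (S g y) * conj (f y) ∂ν

/-- `f` lies in `L²₀(Y, ν)`, the space of square-integrable functions of zero mean. -/
def MemL2Zero (ν : Measure Y) (f : Y → ℂ) : Prop :=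
  MemLp f 2 ν ∧ ∫ y, f y ∂ν = 0

/-- `σ` is (a measure in the class of) the maximal spectral type of `S` on `L²₀(Y, ν)`: it dominates
the spectral measure of every `f ∈ L²₀(Y, ν)` and is equivalent to one of them. -/
structure IsMaximalSpectralType (S : G → Y → Y) (ν : Measure Y)
    (σ : Measure (PontryaginDual G)) : Prop where
  dominates : ∀ f, MemL2Zero ν f → ∃ τ, IsSpectralMeasure S ν f τ ∧ τ ≪ σ
  realized : ∃ f τ, MemL2Zero ν f ∧ IsSpectralMeasure S ν f τ ∧ τ ≪ σ ∧ σ ≪ τ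

end Actions

section Extension

variable {X Y G : Type*}

/-- The Rokhlin `(φ, S)`-extension `(x, y) ↦ (T x, S_{φ(x)} y)` of `T`. -/
def rokhlinExtension (T : X → X) (φ : X → G) (S : G → Y → Y) : X × Y → X × Y :=
  fun p => (T p.1, S (φ p.1) p.2)

/-- The group `Σ_φ` of the characters `χ` such that `χ ∘ φ` is a quasi-coboundary, that is
`χ ∘ φ = c · ξ / (ξ ∘ T)` almost everywhere for a constant `c` and a measurable `ξ` of modulus `1`. -/
def quasiCoboundaryGroup [CommGroup G] [TopologicalSpace G] [MeasurableSpace X]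
    (T : X → X) (μ : Measure X) (φ : X → G) : Subgroup (PontryaginDual G) where
  carrier := {χ | ∃ (c : Circle) (ξ : X → Circle), Measurable (fun x => (ξ x : ℂ)) ∧
    ∀ᵐ x ∂μ, χ (φ x) = c * (ξ x / ξ (T x))}
  mul_mem' := by
    rintro χ₁ χ₂ ⟨c₁, ξ₁, h₁, e₁⟩ ⟨c₂, ξ₂, h₂, e₂⟩
    refine ⟨c₁ * c₂, fun x => ξ₁ x * ξ₂ x, ?_, ?_⟩
    · simp only [Circle.coe_mul]
      exact Measurable.mul h₁ h₂
    filter_upwards [e₁, e₂] with x hx₁ hx₂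
    change χ₁ (φ x) * χ₂ (φ x) = _
    rw [hx₁, hx₂, mul_div_mul_comm, mul_mul_mul_comm]
  one_mem' := by
    refine ⟨1, fun _ => 1, by simp, ?_⟩
    filter_upwards with x
    change (1 : Circle) = _
    simp
  inv_mem' := by
    rintro χ ⟨c, ξ, h, e⟩
    refine ⟨c⁻¹, fun x => (ξ x)⁻¹, ?_, ?_⟩
    · simp only [Circle.coe_inv]
      exact Measurable.inv h
    filter_upwards [e] with x hx
    change (χ (φ x))⁻¹ = _
    rw [hx, mul_inv, inv_div_inv, inv_div]

end Extension

end RokhlinExtension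

/-! Write R for the extension. Centring the indicator of a set in a rigid factor gives a bounded
mean-zero f with f ∘ R^(q n) → f in L², and the claim is that such an f vanishes.

Mild mixing of T enters as one principle, `MildlyMixing.ae_eq_const_of_tendstoInMeasure`: the sets
rigid along q form a rigid factor, hence a trivial one, so a map recurrent along q is constant. The
fibre integral of f is recurrent under T, hence constant, hence zero.

For the rest, fix a bounded mean-zero h on Y with spectral measure τ. The functions a(x) h(S_{ψ(x)}
y) and a(x) χ(ψ(x)) have the same Gram matrix, so `exists_intertwiner` carries f to some F in L²(τ ⊗
μ), and the Koopman operator to F ↦ χ(φ(x)) F(χ, Tx). For τ-almost every χ the slice F(χ, ·) is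
recurrent for this weighted operator, and by `MildlyMixing.exists_quasiCoboundary` a nonzero slice
makes χ ∘ φ a quasi-coboundary. Such χ are τ-null, so F = 0 and f is orthogonal to every test
function. With h = 1_D - ν(D) and the vanishing fibre integrals, f integrates to zero over
rectangles. -/

namespace RokhlinExtension

/-! ### Rigid sets and recurrence under mild mixing -/

section Rigidity

variable {X : Type*} [mX : MeasurableSpace X] {μ : Measure X} {T : X → X} {q : ℕ → ℕ}

/-- The set `A` is rigid along `q`: `μ (T⁻ᵠ A ∆ A) → 0`. -/
def IsRigidSet (T : X → X) (μ : Measure X) (q : ℕ → ℕ) (A : Set X) : Prop :=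
  Tendsto (fun n => μ (symmDiff (T^[q n] ⁻¹' A) A)) atTop (𝓝 0)

theorem IsRigidSet.compl {A : Set X} (hA : IsRigidSet T μ q A) : IsRigidSet T μ q Aᶜ := by
  refine hA.congr fun n => ?_
  rw [Set.preimage_compl, compl_symmDiff_compl]

theorem IsRigidSet.union {A B : Set X} (hA : IsRigidSet T μ q A) (hB : IsRigidSet T μ q B) :
    IsRigidSet T μ q (A ∪ B) := by
  have h := hA.add hB
  rw [add_zero] at h
  refine tendsto_of_tendsto_of_tendsto_of_le_of_le tendsto_const_nhds h (fun _ => zero_le) fun n => ?_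
  refine (measure_mono ?_).trans (measure_union_le _ _)
  intro x
  simp only [Set.mem_symmDiff, Set.mem_union, Set.mem_preimage]
  tauto

/-- Replacing A by B costs μ (A ∆ B) twice, before and after the shift, uniformly in n because the
iterates preserve μ. -/
theorem isRigidSet_of_approx (hT : MeasurePreserving T μ μ) {A : Set X} (hA : MeasurableSet A)
    (h : ∀ ε : ℝ≥0∞, 0 < ε → ∃ B, MeasurableSet B ∧ IsRigidSet T μ q B ∧ μ (symmDiff A B) ≤ ε) :
    IsRigidSet T μ q A := by
  rw [IsRigidSet, ENNReal.tendsto_nhds_zero]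
  intro ε hε
  have hε3 : 0 < ε / 3 := ENNReal.div_pos hε.ne' (by simp)
  obtain ⟨B, hB, hBr, hAB⟩ := h (ε / 3) hε3
  filter_upwards [ENNReal.tendsto_nhds_zero.1 hBr (ε / 3) hε3] with n hn
  have h1 : μ (symmDiff (T^[q n] ⁻¹' A) (T^[q n] ⁻¹' B)) ≤ ε / 3 := by
    rw [← Set.preimage_symmDiff,
      (hT.iterate (q n)).measure_preimage (hA.symmDiff hB).nullMeasurableSet]
    exact hAB
  calc μ (symmDiff (T^[q n] ⁻¹' A) A)
      ≤ μ (symmDiff (T^[q n] ⁻¹' A) (T^[q n] ⁻¹' B)) + μ (symmDiff (T^[q n] ⁻¹' B) A) :=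
        measure_symmDiff_le _ _ _
    _ ≤ μ (symmDiff (T^[q n] ⁻¹' A) (T^[q n] ⁻¹' B)) +
        (μ (symmDiff (T^[q n] ⁻¹' B) B) + μ (symmDiff B A)) := by
        gcongr; exact measure_symmDiff_le _ _ _
    _ ≤ ε / 3 + (ε / 3 + ε / 3) := by
        gcongr; rwa [symmDiff_comm]
    _ = ε := by rw [← add_assoc, ENNReal.add_thirds]

theorem IsRigidSet.iUnion [IsFiniteMeasure μ] (hT : MeasurePreserving T μ μ) {A : ℕ → Set X}
    (hA : ∀ i, MeasurableSet (A i)) (hAr : ∀ i, IsRigidSet T μ q (A i)) :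
    IsRigidSet T μ q (⋃ i, A i) := by
  have hacc : ∀ N, MeasurableSet (Set.accumulate A N) ∧ IsRigidSet T μ q (Set.accumulate A N) := by
    intro N
    induction N with
    | zero => simpa [Set.accumulate_zero_nat] using ⟨hA 0, hAr 0⟩
    | succ N ih =>
      rw [Set.accumulate_succ]
      exact ⟨ih.1.union (hA _), ih.2.union (hAr _)⟩
  refine isRigidSet_of_approx hT (MeasurableSet.iUnion hA) fun ε hε => ?_
  have hlim : Tendsto (fun N => μ ((⋃ i, A i) \ Set.accumulate A N)) atTop (𝓝 0) := by
    have := tendsto_measure_iInter_atTop (μ := μ)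
      (s := fun N => (⋃ i, A i) \ Set.accumulate A N)
      (fun N => ((MeasurableSet.iUnion hA).diff (hacc N).1).nullMeasurableSet)
      (fun N M h => Set.sdiff_subset_sdiff_right (Set.monotone_accumulate h))
      ⟨0, measure_ne_top _ _⟩
    have h0 : ⋂ N, (⋃ i, A i) \ Set.accumulate A N = ∅ := by
      rw [← Set.sdiff_iUnion, Set.iUnion_accumulate, Set.sdiff_self]
    rwa [h0, measure_empty] at this
  obtain ⟨N, hN⟩ := (ENNReal.tendsto_nhds_zero.1 hlim ε hε).exists
  refine ⟨_, (hacc N).1, (hacc N).2, ?_⟩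
  rwa [symmDiff_of_ge (Set.accumulate_subset_iUnion N)]

/-- The `σ`-algebra of the measurable sets that are rigid along `q`. -/
@[reducible] def rigidAlgebra [IsFiniteMeasure μ] (hT : MeasurePreserving T μ μ) (q : ℕ → ℕ) :
    MeasurableSpace X where
  MeasurableSet' A := MeasurableSet[mX] A ∧ IsRigidSet T μ q A
  measurableSet_empty := ⟨MeasurableSet.empty, by simp [IsRigidSet]⟩
  measurableSet_compl _ h := ⟨h.1.compl, h.2.compl⟩
  measurableSet_iUnion _ h :=
    ⟨MeasurableSet.iUnion fun i => (h i).1, IsRigidSet.iUnion hT (fun i => (h i).1) fun i => (h i).2⟩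

theorem rigidAlgebra_le [IsFiniteMeasure μ] (hT : MeasurePreserving T μ μ) (q : ℕ → ℕ) :
    rigidAlgebra hT q ≤ mX := fun _ h => h.1

/-- T commutes with its iterates, so A and T⁻¹A have the same rigidity defect. The set R⁻¹A, with R
the inverse modulo null sets, handles the opposite inclusion. -/
theorem isFactor_rigidAlgebra [IsFiniteMeasure μ] (hT : IsAutomorphism T μ) (q : ℕ → ℕ) :
    @IsFactor X (rigidAlgebra hT.measurePreserving q) mX T μ := by
  have hmp := hT.measurePreserving
  have key : ∀ (A : Set X) (n : ℕ), MeasurableSet A →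
      μ (symmDiff (T^[q n] ⁻¹' (T ⁻¹' A)) (T ⁻¹' A)) = μ (symmDiff (T^[q n] ⁻¹' A) A) := by
    intro A n hA
    have : T^[q n] ⁻¹' (T ⁻¹' A) = T ⁻¹' (T^[q n] ⁻¹' A) := by
      rw [← Set.preimage_comp, ← Set.preimage_comp, ← Function.iterate_succ',
        ← Function.iterate_succ]
    rw [this, ← Set.preimage_symmDiff, hmp.measure_preimage
      (((hmp.iterate (q n)).measurable hA).symmDiff hA).nullMeasurableSet]
  refine ⟨rigidAlgebra_le _ q, fun A hA => ⟨T ⁻¹' A, ⟨hmp.measurable hA.1, ?_⟩, .rfl⟩,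
    fun A hA => ?_⟩
  · exact hA.2.congr fun n => (key A n hA.1).symm
  · obtain ⟨R, hR, hRT, -⟩ := hT.exists_inverse
    have hpre : T ⁻¹' (R ⁻¹' A) =ᵐ[μ] A := by
      filter_upwards [hRT] with x hx
      exact congrArg (· ∈ A) hx
    refine ⟨R ⁻¹' A, ⟨hR hA.1, hA.2.congr fun n => ?_⟩, hpre⟩
    rw [← key _ n (hR hA.1)]
    refine measure_congr (EventuallyEq.symmDiff ?_ hpre).symm
    exact (hmp.iterate (q n)).quasiMeasurePreserving.preimage_ae_eq hpre

theorem IsRigidSet.tendsto_eLpNorm_indicator {A : Set X} (hT : MeasurePreserving T μ μ)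
    (hm : MeasurableSet A) (hA : IsRigidSet T μ q A) (c : ℂ) :
    Tendsto (fun n => eLpNorm
      (fun x => A.indicator (fun _ => c) (T^[q n] x) - A.indicator (fun _ => c) x) 2 μ)
      atTop (𝓝 0) := by
  have h : ∀ n, eLpNorm
      (fun x => A.indicator (fun _ => c) (T^[q n] x) - A.indicator (fun _ => c) x) 2 μ
      = ‖c‖ₑ * μ (symmDiff (T^[q n] ⁻¹' A) A) ^ (1 / (2 : ℝ)) := by
    intro n
    rw [← ENNReal.toReal_ofNat 2, ← eLpNorm_indicator_const
      (((hT.iterate (q n)).measurable hm).symmDiff hm) (by simp) (by simp)]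
    refine eLpNorm_congr_norm_ae (.of_forall fun x => ?_)
    by_cases h1 : T^[q n] x ∈ A <;> by_cases h2 : x ∈ A <;>
      simp [Set.indicator, Set.mem_symmDiff, h1, h2]
  simp_rw [h]
  have h2 := (ENNReal.continuous_rpow_const (y := 1 / (2 : ℝ))).tendsto 0 |>.comp hA
  have h3 := ENNReal.Tendsto.const_mul (a := ‖c‖ₑ) h2 (Or.inr enorm_ne_top)
  simpa using h3

/-- Density of simple functions reduces this to indicators of rigid sets. It is applied to the
trimmed measure so that the approximants are measurable for the rigid algebra. -/
theorem tendsto_eLpNorm_of_rigidAlgebra [IsFiniteMeasure μ] (hT : MeasurePreserving T μ μ)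
    {f : X → ℂ} (hf : StronglyMeasurable[rigidAlgebra hT q] f) (hf2 : MemLp f 2 μ) :
    Tendsto (fun n => eLpNorm (fun x => f (T^[q n] x) - f x) 2 μ) atTop (𝓝 0) := by
  have hle := rigidAlgebra_le hT q
  have hf2' : MemLp f 2 (μ.trim hle) :=
    ⟨hf.aestronglyMeasurable, by rw [eLpNorm_trim hle hf]; exact hf2.2⟩
  rw [ENNReal.tendsto_nhds_zero]
  intro ε hε
  have hε3 : ε / 3 ≠ 0 := (ENNReal.div_pos hε.ne' (by simp)).ne'
  obtain ⟨g, hfg, hg, hgr⟩ := @MemLp.induction_dense X ℂ (rigidAlgebra hT q) _ 2 (μ.trim hle)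
    (by simp) (fun g => StronglyMeasurable[rigidAlgebra hT q] g ∧
      Tendsto (fun n => eLpNorm (fun x => g (T^[q n] x) - g x) 2 μ) atTop (𝓝 0))
    (fun c s hs _ ε _ => ⟨s.indicator fun _ => c, by simp,
      stronglyMeasurable_const.indicator hs, hs.2.tendsto_eLpNorm_indicator hT hs.1 c⟩)
    (fun g₁ g₂ h₁ h₂ => by
      refine ⟨h₁.1.add h₂.1, ?_⟩
      have h := h₁.2.add h₂.2
      rw [add_zero] at h
      refine tendsto_of_tendsto_of_tendsto_of_le_of_le tendsto_const_nhds h (fun _ => zero_le)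
        fun n => ?_
      have hi := (hT.iterate (q n)).measurable
      have m₁ := h₁.1.mono hle
      have m₂ := h₂.1.mono hle
      refine le_trans (le_of_eq ?_) (eLpNorm_add_le
        ((m₁.comp_measurable hi).sub m₁).aestronglyMeasurable
        ((m₂.comp_measurable hi).sub m₂).aestronglyMeasurable (by norm_num))
      congr 1
      ext x
      simp only [Pi.add_apply]
      ring)
    (fun g h => h.1.aestronglyMeasurable) f hf2' (ε / 3) hε3
  rw [eLpNorm_trim hle (hf.sub hg)] at hfg
  filter_upwards [ENNReal.tendsto_nhds_zero.1 hgr (ε / 3) (pos_iff_ne_zero.2 hε3)] with n hn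
  have hi := hT.iterate (q n)
  have mf := hf.mono hle
  have mg := hg.mono hle
  have h1 : eLpNorm ((f - g) ∘ T^[q n]) 2 μ ≤ ε / 3 := by
    rwa [eLpNorm_comp_measurePreserving (mf.sub mg).aestronglyMeasurable hi]
  have hsum : (fun x => f (T^[q n] x) - f x) =
      (f - g) ∘ T^[q n] + ((fun x => g (T^[q n] x) - g x) - (f - g)) := by
    ext x
    simp only [Pi.add_apply, Pi.sub_apply, Function.comp_apply]
    ring
  have mg' : StronglyMeasurable fun x => g (T^[q n] x) - g x :=
    (mg.comp_measurable hi.measurable).sub mg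
  calc eLpNorm (fun x => f (T^[q n] x) - f x) 2 μ
      ≤ eLpNorm ((f - g) ∘ T^[q n]) 2 μ +
        eLpNorm ((fun x => g (T^[q n] x) - g x) - (f - g)) 2 μ := by
        rw [hsum]
        exact eLpNorm_add_le ((mf.sub mg).comp_measurable hi.measurable).aestronglyMeasurable
          (mg'.sub (mf.sub mg)).aestronglyMeasurable (by norm_num)
    _ ≤ ε / 3 + (ε / 3 + ε / 3) := by
        refine add_le_add h1 ((eLpNorm_sub_le mg'.aestronglyMeasurable
          (mf.sub mg).aestronglyMeasurable (by norm_num)).trans (add_le_add hn hfg))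
    _ = ε := by rw [← add_assoc, ENNReal.add_thirds]

/-- A preimage of a closed set under a map that is recurrent in measure along `q` is rigid. -/
theorem isRigidSet_preimage_of_isClosed [IsFiniteMeasure μ] (hT : MeasurePreserving T μ μ)
    {E : Type*} [PseudoMetricSpace E] [MeasurableSpace E] [BorelSpace E] {F : X → E}
    (hF : Measurable F) (hlim : TendstoInMeasure μ (fun n x => F (T^[q n] x)) atTop F)
    {C : Set E} (hC : IsClosed C) : IsRigidSet T μ q (F ⁻¹' C) := by
  rw [IsRigidSet, ENNReal.tendsto_nhds_zero]
  intro ε hε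
  have hε3 : 0 < ε / 3 := ENNReal.div_pos hε.ne' (by simp)
  -- As C is closed, the shell between C and its r-thickening has small measure for small r.
  have hthick : Tendsto (fun r => (μ.map F) (Metric.cthickening r C)) (𝓝[>] 0)
      (𝓝 ((μ.map F) C)) :=
    (tendsto_measure_cthickening_of_isClosed ⟨1, one_pos, measure_ne_top _ _⟩ hC).mono_left
      nhdsWithin_le_nhds
  have hdiff : Tendsto (fun r => (μ.map F) (Metric.cthickening r C \ C)) (𝓝[>] 0) (𝓝 0) := by
    have h := ENNReal.Tendsto.sub hthick (tendsto_const_nhds (x := (μ.map F) C))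
      (Or.inl (measure_ne_top _ _))
    rw [tsub_self] at h
    refine h.congr fun r => ?_
    rw [measure_sdiff (Metric.self_subset_cthickening C) hC.measurableSet.nullMeasurableSet
      (measure_ne_top _ _)]
  obtain ⟨r, hr, hr0⟩ := ((ENNReal.tendsto_nhds_zero.1 hdiff (ε / 3) hε3).and
    self_mem_nhdsWithin).exists
  have hr0 : 0 < r := hr0
  have hDm : MeasurableSet (Metric.cthickening r C \ C) :=
    Metric.isClosed_cthickening.measurableSet.diff hC.measurableSet
  rw [Measure.map_apply hF hDm] at hr
  filter_upwards [ENNReal.tendsto_nhds_zero.1 (hlim (ENNReal.ofReal r) (by simpa)) (ε / 3) hε3]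
    with n hn
  have hr' : μ (T^[q n] ⁻¹' (F ⁻¹' (Metric.cthickening r C \ C))) ≤ ε / 3 := by
    rwa [(hT.iterate (q n)).measure_preimage (hF hDm).nullMeasurableSet]
  -- If F moves by less than r and only one of the two values lies in C, the other lies in the
  -- shell.
  have hsub : symmDiff (T^[q n] ⁻¹' (F ⁻¹' C)) (F ⁻¹' C) ⊆
      {x | ENNReal.ofReal r ≤ edist (F (T^[q n] x)) (F x)} ∪
      (T^[q n] ⁻¹' (F ⁻¹' (Metric.cthickening r C \ C)) ∪ F ⁻¹' (Metric.cthickening r C \ C)) := by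
    intro x hx
    by_cases hd : ENNReal.ofReal r ≤ edist (F (T^[q n] x)) (F x)
    · exact Or.inl hd
    · have hd' : dist (F (T^[q n] x)) (F x) ≤ r := by
        rw [edist_dist] at hd
        exact le_of_lt (by
          by_contra! h
          exact hd (ENNReal.ofReal_le_ofReal h))
      rcases hx with ⟨h1, h2⟩ | ⟨h1, h2⟩
      · refine Or.inr (Or.inr ⟨Metric.mem_cthickening_of_dist_le _ _ _ _ h1 ?_, h2⟩)
        rwa [dist_comm]
      · exact Or.inr (Or.inl ⟨Metric.mem_cthickening_of_dist_le _ _ _ _ h1 hd', h2⟩)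
  calc μ (symmDiff (T^[q n] ⁻¹' (F ⁻¹' C)) (F ⁻¹' C)) ≤ ε / 3 + (ε / 3 + ε / 3) :=
        (measure_mono hsub).trans ((measure_union_le _ _).trans
          (add_le_add hn ((measure_union_le _ _).trans (add_le_add hr' hr))))
    _ = ε := by rw [← add_assoc, ENNReal.add_thirds]

/-- Under a mildly mixing automorphism, a measurable map that is recurrent in measure along a
sequence tending to infinity is almost everywhere constant. -/
theorem MildlyMixing.ae_eq_const_of_tendstoInMeasure [IsProbabilityMeasure μ]
    (hT : MildlyMixing T μ) (hq : Tendsto q atTop atTop)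
    {E : Type*} [MetricSpace E] [SecondCountableTopology E] [MeasurableSpace E] [BorelSpace E]
    {F : X → E} (hF : Measurable F)
    (hlim : TendstoInMeasure μ (fun n x => F (T^[q n] x)) atTop F) :
    ∃ c, ∀ᵐ x ∂μ, F x = c := by
  have hmp := hT.isAutomorphism.measurePreserving
  have htriv := hT.trivial_of_rigid (rigidAlgebra hmp q)
    ⟨isFactor_rigidAlgebra hT.isAutomorphism q, q, hq,
      fun f hf hf2 => tendsto_eLpNorm_of_rigidAlgebra hmp hf hf2⟩
  have hmeas : Measurable[rigidAlgebra hmp q] F :=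
    @measurable_of_isClosed _ _ _ _ _ (rigidAlgebra hmp q) _ fun C hC =>
      ⟨hF hC.measurableSet, isRigidSet_preimage_of_isClosed hmp hF hlim hC⟩
  obtain ⟨x₀⟩ : Nonempty X := nonempty_of_isProbabilityMeasure μ
  have : Nonempty E := ⟨F x₀⟩
  -- Countably many measurable sets separate the points of E, so it suffices that each preimage is
  -- null or co-null.
  refine exists_eventuallyEq_const_of_forall_separating (l := ae μ) MeasurableSet fun U hU => ?_
  rcases htriv _ (hmeas hU) with h | h
  · exact Or.inr (measure_eq_zero_iff_ae_notMem.1 h)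
  · exact Or.inl h

end Rigidity

/-! ### Weighted composition operators and quasi-coboundaries -/

section WeightedComposition

variable {X : Type*}

/-- The weighted composition operator `F ↦ a · F ∘ T` on functions. -/
def weightedComp (a : X → Circle) (T : X → X) (F : X → ℂ) : X → ℂ :=
  fun x => a x * F (T x)

theorem norm_iterate_weightedComp (a : X → Circle) (T : X → X) (F : X → ℂ) (n : ℕ) (x : X) :
    ‖(weightedComp a T)^[n] F x‖ = ‖F (T^[n] x)‖ := by
  induction n generalizing x with
  | zero => rfl
  | succ n ih =>
    rw [Function.iterate_succ_apply', weightedComp, norm_mul, Circle.norm_coe, one_mul, ih,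
      Function.iterate_succ_apply]

/-- The unimodular weights accumulated along the orbit cancel against their conjugates. Thus
recurrence of F under the weighted operator becomes recurrence of the left-hand product under T
itself. -/
theorem weightedComp_mul_conj_iterate (a : X → Circle) (T : X → X) (F : X → ℂ) (n : ℕ) (x : X) :
    weightedComp a T F (T^[n] x) * conj (F (T^[n] x)) =
      a x * (weightedComp a T)^[n] F (T x) * conj ((weightedComp a T)^[n] F x) := by
  induction n generalizing x with
  | zero => rfl
  | succ n ih =>
    have ha : (a x : ℂ) * conj (a x : ℂ) = 1 := by simp [Complex.mul_conj]
    rw [Function.iterate_succ_apply, ih (T x), Function.iterate_succ_apply', weightedComp,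
      weightedComp, map_mul]
    linear_combination (-(a (T x) : ℂ) * (weightedComp a T)^[n] F (T (T x)) *
      conj ((weightedComp a T)^[n] F (T x))) * ha

theorem iterate_weightedComp_one (T : X → X) (F : X → ℂ) (n : ℕ) :
    (weightedComp (fun _ => 1) T)^[n] F = F ∘ T^[n] := by
  induction n with
  | zero => rfl
  | succ n ih =>
    rw [Function.iterate_succ_apply', ih]
    ext x
    simp [weightedComp]

theorem iterate_weightedComp_prod {Z : Type*} (T : X → X) (a : Z × X → Circle) (F : Z × X → ℂ) (n : ℕ) (z : Z)
    (x : X) : (weightedComp a (Prod.map id T))^[n] F (z, x) =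
      (weightedComp (fun x => a (z, x)) T)^[n] (fun x => F (z, x)) x := by
  induction n generalizing x with
  | zero => rfl
  | succ n ih =>
    rw [Function.iterate_succ_apply', Function.iterate_succ_apply', weightedComp, weightedComp,
      ← ih]
    rfl

variable [mX : MeasurableSpace X] {μ : Measure X} [IsProbabilityMeasure μ] {T : X → X} {q : ℕ → ℕ}

/-- Over a mildly mixing automorphism, a circle-valued cocycle whose weighted composition operator
has a nonzero recurrent function is a quasi-coboundary. -/
theorem MildlyMixing.exists_quasiCoboundary (hT : MildlyMixing T μ) (hq : Tendsto q atTop atTop)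
    {a : X → Circle} (ha : Measurable fun x => (a x : ℂ)) {F : X → ℂ} (hF : Measurable F)
    (hlim : ∀ᵐ x ∂μ, Tendsto (fun n => (weightedComp a T)^[q n] F x) atTop (𝓝 (F x)))
    (hne : ¬ F =ᵐ[μ] 0) :
    ∃ (c : Circle) (ξ : X → Circle), Measurable (fun x => (ξ x : ℂ)) ∧
      ∀ᵐ x ∂μ, a x = c * (ξ x / ξ (T x)) := by
  have hmp := hT.isAutomorphism.measurePreserving
  have hTm := hmp.measurable
  -- The weights have modulus one, so ‖F‖ is recurrent under T.
  obtain ⟨r, hr⟩ : ∃ r, ∀ᵐ x ∂μ, ‖F x‖ = r := by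
    refine hT.ae_eq_const_of_tendstoInMeasure hq hF.norm (tendstoInMeasure_of_tendsto_ae
      (fun n => (hF.norm.comp (hTm.iterate _)).aestronglyMeasurable) ?_)
    filter_upwards [hlim] with x hx
    refine hx.norm.congr fun n => norm_iterate_weightedComp a T F _ x
  have hθm : Measurable fun x => weightedComp a T F x * conj (F x) :=
    (ha.mul (hF.comp hTm)).mul (Complex.continuous_conj.measurable.comp hF)
  obtain ⟨d, hd⟩ : ∃ d, ∀ᵐ x ∂μ, weightedComp a T F x * conj (F x) = d := by
    refine hT.ae_eq_const_of_tendstoInMeasure hq hθm (tendstoInMeasure_of_tendsto_ae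
      (fun n => (hθm.comp (hTm.iterate _)).aestronglyMeasurable) ?_)
    filter_upwards [hlim, hmp.quasiMeasurePreserving.ae hlim] with x hx hx'
    refine (((tendsto_const_nhds (x := (a x : ℂ))).mul hx').mul
      ((Complex.continuous_conj.tendsto _).comp hx)).congr fun n => ?_
    exact (weightedComp_mul_conj_iterate a T F _ x).symm
  have hrT := hmp.quasiMeasurePreserving.ae hr
  have hr0 : r ≠ 0 := by
    rintro rfl
    exact hne (hr.mono fun x hx => norm_eq_zero.1 hx)
  have hdn : ‖d‖ = r * r := by
    obtain ⟨x, h1, h2, h3⟩ := (hr.and (hrT.and hd)).exists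
    rw [← h3, weightedComp]
    rw [norm_mul, norm_mul, Circle.norm_coe, one_mul, RCLike.norm_conj, h1, h2]
  -- The constant is the phase of d and ξ the phase of F: cancelling r² in a · (F ∘ T) · conj F = d
  -- leaves a · (ξ ∘ T) / ξ = c.
  refine ⟨Circle.exp (Complex.arg d), fun x => Circle.exp (Complex.arg (F x)), ?_, ?_⟩
  · simp only [Circle.coe_exp]
    fun_prop
  filter_upwards [hr, hrT, hd] with x h1 h2 h3
  set e := Circle.exp (Complex.arg (F x))
  set e' := Circle.exp (Complex.arg (F (T x)))
  set c := Circle.exp (Complex.arg d)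
  have he : F x = r * e := by
    rw [← h1, Circle.coe_exp, Complex.norm_mul_exp_arg_mul_I]
  have he' : F (T x) = r * e' := by
    rw [← h2, Circle.coe_exp, Complex.norm_mul_exp_arg_mul_I]
  have hc : d = r * r * c := by
    rw [← Complex.ofReal_mul, ← hdn, Circle.coe_exp, Complex.norm_mul_exp_arg_mul_I]
  have hr0' : (r : ℂ) ≠ 0 := Complex.ofReal_ne_zero.2 hr0
  rw [weightedComp, he, he', hc, map_mul, Complex.conj_ofReal, ← Circle.coe_inv_eq_conj] at h3
  have h4 : (a x * e' * e⁻¹ : Circle) = c := by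
    refine Circle.ext (mul_left_cancel₀ (mul_ne_zero hr0' hr0') ?_)
    rw [← h3, Circle.coe_mul, Circle.coe_mul]
    ring
  rw [← h4]
  simp [div_eq_mul_inv, mul_assoc]

end WeightedComposition

/-! ### Intertwiners from equal Gram matrices -/

section Gram

variable {ι H₁ H₂ : Type*} [NormedAddCommGroup H₁] [InnerProductSpace ℂ H₁] [CompleteSpace H₁]
  [NormedAddCommGroup H₂] [InnerProductSpace ℂ H₂] [CompleteSpace H₂]

/-- Families with the same Gram matrix that are permuted compatibly by isometries `U` and `M` are
related by a bounded intertwiner whose kernel is orthogonal to the first family. -/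
theorem exists_intertwiner {v : ι → H₁} {w : ι → H₂}
    (hgram : ∀ i j, inner ℂ (v i) (v j) = inner ℂ (w i) (w j))
    (U : H₁ →ₗᵢ[ℂ] H₁) (M : H₂ →ₗᵢ[ℂ] H₂)
    (hmap : ∀ i, ∃ j, U (v i) = v j ∧ M (w i) = w j) (hsurj : ∀ i, ∃ j, U (v j) = v i) :
    ∃ V : H₁ →L[ℂ] H₂, (∀ f, V (U f) = M (V f)) ∧ ∀ f, V f = 0 → ∀ i, inner ℂ (v i) f = 0 := by
  let K : Submodule ℂ H₁ := (Submodule.span ℂ (Set.range v)).topologicalClosure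
  have hvK : ∀ i, v i ∈ K := fun i =>
    Submodule.le_topologicalClosure _ (Submodule.subset_span ⟨i, rfl⟩)
  have : CompleteSpace K := (Submodule.isClosed_topologicalClosure _).completeSpace_coe
  -- The v i may be linearly dependent, so the map v i ↦ w i is built on formal combinations; equal
  -- Gram matrices make it isometric there.
  let e : (ι →₀ ℂ) →ₗ[ℂ] K := Finsupp.linearCombination ℂ fun i => (⟨v i, hvK i⟩ : K)
  let b : (ι →₀ ℂ) →ₗ[ℂ] H₂ := Finsupp.linearCombination ℂ w
  have he : ∀ c, (e c : H₁) = Finsupp.linearCombination ℂ v c := fun c => by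
    simp [e, Finsupp.linearCombination_apply, Finsupp.sum]
  have hnorm : ∀ c, ‖b c‖ = ‖e c‖ := by
    intro c
    have h : inner ℂ (b c) (b c) = inner ℂ (e c : H₁) (e c : H₁) := by
      rw [he]
      simp only [b, Finsupp.linearCombination_apply, Finsupp.sum, sum_inner, inner_sum,
        inner_smul_left, inner_smul_right, hgram]
    rw [inner_self_eq_norm_sq_to_K, inner_self_eq_norm_sq_to_K] at h
    have h' : ‖b c‖ ^ 2 = ‖(e c : H₁)‖ ^ 2 := by exact_mod_cast h
    rw [Submodule.coe_norm]
    exact (sq_eq_sq₀ (norm_nonneg _) (norm_nonneg _)).1 h'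
  have hdense : DenseRange e := by
    intro x
    rw [Metric.mem_closure_iff]
    intro ε hε
    obtain ⟨y, hy, hxy⟩ := Metric.mem_closure_iff.1 x.2 ε hε
    obtain ⟨c, rfl⟩ := (Finsupp.mem_span_range_iff_exists_finsupp.1 hy)
    refine ⟨e c, ⟨c, rfl⟩, ?_⟩
    rw [Subtype.dist_eq, he]
    simpa [Finsupp.linearCombination_apply] using hxy
  have hbd : ∃ C, ∀ c, ‖b c‖ ≤ C * ‖e c‖ := ⟨1, fun c => by rw [hnorm, one_mul]⟩
  let V₀ : K →L[ℂ] H₂ := b.extendOfNorm e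
  have hV₀ : ∀ c, V₀ (e c) = b c := LinearMap.extendOfNorm_eq hdense hbd
  have hV₀v : ∀ i, V₀ ⟨v i, hvK i⟩ = w i := fun i => by
    have := hV₀ (Finsupp.single i 1)
    simpa [e, b] using this
  have hV₀n : ∀ k, ‖V₀ k‖ = ‖k‖ := by
    intro k
    refine hdense.induction_on (p := fun k => ‖V₀ k‖ = ‖k‖) k
      (isClosed_eq (V₀.continuous.norm) continuous_norm) fun c => ?_
    rw [hV₀, hnorm]
  have hUK : ∀ k ∈ K, U k ∈ K := by
    intro k hk
    have : K ≤ K.comap U.toLinearMap := by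
      refine Submodule.topologicalClosure_minimal _ (Submodule.span_le.2 ?_)
        ((Submodule.isClosed_topologicalClosure _).preimage U.continuous)
      rintro _ ⟨i, rfl⟩
      obtain ⟨j, hj, -⟩ := hmap i
      change U (v i) ∈ K
      rw [hj]
      exact hvK j
    exact this hk
  have horth : ∀ f, (∀ i, inner ℂ (v i) f = 0) ↔ f ∈ Kᗮ := by
    intro f
    constructor
    · intro h
      have : K ≤ (ℂ ∙ f)ᗮ := by
        refine Submodule.topologicalClosure_minimal _ (Submodule.span_le.2 ?_)
          (Submodule.isClosed_orthogonal _)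
        rintro _ ⟨i, rfl⟩
        exact Submodule.mem_orthogonal_singleton_iff_inner_left.2 (h i)
      intro k hk
      exact Submodule.mem_orthogonal_singleton_iff_inner_left.1 (this hk)
    · intro h i
      exact h _ (hvK i)
  -- `hsurj` is needed here: an isometry mapping K into itself need not preserve Kᗮ unless it maps K
  -- onto a dense part of K.
  have hUperp : ∀ f ∈ Kᗮ, U f ∈ Kᗮ := by
    intro f hf
    rw [← horth] at hf ⊢
    intro i
    obtain ⟨j, hj⟩ := hsurj i
    rw [← hj, U.inner_map_map]
    exact hf j
  have hcomm : ∀ k : K, V₀ ⟨U k, hUK k k.2⟩ = M (V₀ k) := by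
    intro k
    refine hdense.induction_on (p := fun k : K => V₀ ⟨U k, hUK k k.2⟩ = M (V₀ k)) k
      (isClosed_eq (V₀.continuous.comp ((U.continuous.comp continuous_subtype_val).subtype_mk _))
        (M.continuous.comp V₀.continuous)) fun c => ?_
    let V₁ : K →ₗ[ℂ] H₂ := V₀.toLinearMap ∘ₗ U.toLinearMap.restrict hUK
    have : V₁ ∘ₗ e = (M.toLinearMap ∘ₗ V₀.toLinearMap) ∘ₗ e := by
      ext i
      obtain ⟨j, hj, hj'⟩ := hmap i
      have h1 : e (Finsupp.single i 1) = ⟨v i, hvK i⟩ := by simp [e]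
      have h2 : U.toLinearMap.restrict hUK ⟨v i, hvK i⟩ = ⟨v j, hvK j⟩ := Subtype.ext hj
      simp only [V₁, LinearMap.comp_apply, Finsupp.lsingle_apply, h1, h2]
      change V₀ _ = M (V₀ _)
      rw [hV₀v, hV₀v, hj']
    exact LinearMap.congr_fun this c
  -- Extend by zero on Kᗮ; since `V₀` is isometric, the kernel is exactly Kᗮ.
  refine ⟨V₀ ∘L K.orthogonalProjectionOnto, fun f => ?_, fun f hf => ?_⟩
  · have hproj : K.orthogonalProjectionOnto (U f) =
        ⟨U (K.orthogonalProjectionOnto f), hUK _ (K.orthogonalProjectionOnto f).2⟩ := by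
      refine Subtype.ext (Submodule.eq_starProjection_of_mem_orthogonal
        (hUK _ (K.orthogonalProjectionOnto f).2) ?_)
      rw [← map_sub]
      exact hUperp _ (K.sub_starProjection_mem_orthogonal f)
    rw [ContinuousLinearMap.comp_apply, ContinuousLinearMap.comp_apply, hproj, hcomm]
  · rw [horth, ← Submodule.orthogonalProjectionOnto_eq_zero_iff, ← norm_eq_zero, ← hV₀n]
    simpa using hf

end Gram

/-! ### Weighted composition as an isometry of L² -/

section WeightedCompositionL2

variable {X : Type*} [MeasurableSpace X] {μ : Measure X} {T : X → X}

theorem memLp_weightedComp {a : X → Circle} (ha : Measurable fun x => (a x : ℂ))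
    (hT : MeasurePreserving T μ μ) {F : X → ℂ} (hF : MemLp F 2 μ) :
    MemLp (weightedComp a T F) 2 μ := by
  have h := hF.comp_measurePreserving hT
  refine h.of_le (ha.aestronglyMeasurable.mul h.1) (.of_forall fun x => ?_)
  rw [weightedComp, norm_mul, Circle.norm_coe, one_mul, Function.comp_apply]

theorem weightedComp_ae_eq (a : X → Circle) (hT : MeasurePreserving T μ μ) {F F' : X → ℂ}
    (h : F =ᵐ[μ] F') : weightedComp a T F =ᵐ[μ] weightedComp a T F' := by
  filter_upwards [hT.quasiMeasurePreserving.ae h] with x hx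
  rw [weightedComp, weightedComp, hx]

/-- The weighted composition operator `F ↦ a · F ∘ T` on `L²`. -/
noncomputable def weightedCompL2 {a : X → Circle} (ha : Measurable fun x => (a x : ℂ))
    (hT : MeasurePreserving T μ μ) : Lp ℂ 2 μ →ₗᵢ[ℂ] Lp ℂ 2 μ where
  toFun F := (memLp_weightedComp ha hT (Lp.memLp F)).toLp _
  map_add' F F' := by
    rw [← MemLp.toLp_add, MemLp.toLp_eq_toLp_iff]
    refine (weightedComp_ae_eq a hT (Lp.coeFn_add F F')).trans (.of_forall fun x => ?_)
    simp [weightedComp, mul_add]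
  map_smul' c F := by
    rw [RingHom.id_apply, ← MemLp.toLp_const_smul, MemLp.toLp_eq_toLp_iff]
    refine (weightedComp_ae_eq a hT (Lp.coeFn_smul c F)).trans (.of_forall fun x => ?_)
    simp [weightedComp, mul_left_comm]
  norm_map' F := by
    change ‖(memLp_weightedComp ha hT (Lp.memLp F)).toLp _‖ = ‖F‖
    rw [Lp.norm_toLp, Lp.norm_def, ← eLpNorm_comp_measurePreserving (Lp.aestronglyMeasurable F) hT]
    refine congrArg _ (eLpNorm_congr_norm_ae (.of_forall fun x => ?_))
    rw [weightedComp, norm_mul, Circle.norm_coe, one_mul, Function.comp_apply]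

theorem coeFn_weightedCompL2 {a : X → Circle} (ha : Measurable fun x => (a x : ℂ))
    (hT : MeasurePreserving T μ μ) (F : Lp ℂ 2 μ) :
    weightedCompL2 ha hT F =ᵐ[μ] weightedComp a T F :=
  (memLp_weightedComp ha hT (Lp.memLp F)).coeFn_toLp

theorem weightedCompL2_toLp {a : X → Circle} (ha : Measurable fun x => (a x : ℂ))
    (hT : MeasurePreserving T μ μ) {F F' : X → ℂ} (hF : MemLp F 2 μ) (hF' : MemLp F' 2 μ)
    (h : weightedComp a T F =ᵐ[μ] F') : weightedCompL2 ha hT (hF.toLp F) = hF'.toLp F' := by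
  refine Lp.ext ?_
  exact (coeFn_weightedCompL2 ha hT _).trans
    (((weightedComp_ae_eq a hT hF.coeFn_toLp).trans h).trans hF'.coeFn_toLp.symm)

theorem coeFn_iterate_weightedCompL2 {a : X → Circle} (ha : Measurable fun x => (a x : ℂ))
    (hT : MeasurePreserving T μ μ) (F : Lp ℂ 2 μ) (n : ℕ) :
    (weightedCompL2 ha hT)^[n] F =ᵐ[μ] (weightedComp a T)^[n] F := by
  induction n with
  | zero => rfl
  | succ n ih =>
    rw [Function.iterate_succ_apply', Function.iterate_succ_apply']
    exact (coeFn_weightedCompL2 ha hT _).trans (weightedComp_ae_eq a hT ih)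

end WeightedCompositionL2

/-! ### Joint measurability of the duality pairing -/

section Evaluation

variable {G : Type*} [CommGroup G] [TopologicalSpace G]

theorem continuous_dual_eval (g : G) : Continuous fun χ : PontryaginDual G => (χ g : ℂ) := by
  have h : Continuous fun χ : G →ₜ* Circle => χ g := continuous_eval_const g
  exact continuous_subtype_val.comp h

/-- A Carathéodory argument: the pairing is continuous in g and measurable in χ, which gives
measurability for the product `σ`-algebra. -/
theorem measurable_dual_eval [IsTopologicalGroup G] [T2Space G] [SecondCountableTopology G]
    [LocallyCompactSpace G] [MeasurableSpace G] [BorelSpace G] :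
    Measurable fun p : PontryaginDual G × G => (p.1 p.2 : ℂ) := by
  have h : Measurable (Function.uncurry fun (g : G) (χ : PontryaginDual G) => (χ g : ℂ)) :=
    measurable_uncurry_of_continuous_of_measurable
      (fun χ => continuous_subtype_val.comp (map_continuous χ))
      fun g => (continuous_dual_eval g).measurable
  exact h.comp measurable_swap

end Evaluation

/-! ### The extension as an automorphism -/

section Automorphism

variable {X Y G : Type*} [MeasurableSpace X] [MeasurableSpace Y]
  [CommGroup G] [MeasurableSpace G] {μ : Measure X} {ν : Measure Y} [SFinite μ] [SFinite ν]
  {T : X → X} {φ : X → G} {S : G → Y → Y}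

theorem measurePreserving_rokhlinExtension (hT : MeasurePreserving T μ μ) (hφ : Measurable φ)
    (hS : IsMeasurableAction S ν) :
    MeasurePreserving (rokhlinExtension T φ S) (μ.prod ν) (μ.prod ν) :=
  hT.skew_product (g := fun x => S (φ x))
    (hS.measurable.comp ((hφ.comp measurable_fst).prodMk measurable_snd))
    (.of_forall fun x => (hS.measurePreserving (φ x)).map_eq)

/-- The inverse is (x, y) ↦ (R x, S_{φ(R x)⁻¹} y). The action law holds only almost everywhere for
each pair of group elements, so it is used fibre by fibre, and Fubini applies because equality sets
are measurable in standard Borel spaces. -/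
theorem isAutomorphism_rokhlinExtension [StandardBorelSpace X] [StandardBorelSpace Y]
    [TopologicalSpace G] [IsTopologicalGroup G] [BorelSpace G]
    (hT : IsAutomorphism T μ) (hφ : Measurable φ) (hS : IsMeasurableAction S ν) :
    IsAutomorphism (rokhlinExtension T φ S) (μ.prod ν) := by
  have hmp := measurePreserving_rokhlinExtension hT.measurePreserving hφ hS
  refine ⟨hmp, ?_⟩
  obtain ⟨R, hR, hRT, hTR⟩ := hT.exists_inverse
  have hRm : Measurable fun p : X × Y => (R p.1, S (φ (R p.1))⁻¹ p.2) :=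
    (hR.comp measurable_fst).prodMk
      (hS.measurable.comp ((hφ.comp (hR.comp measurable_fst)).inv.prodMk measurable_snd))
  refine ⟨_, hRm, ?_, ?_⟩
  · refine (Measure.ae_prod_iff_ae_ae
      (measurableSet_eq_fun (hRm.comp hmp.measurable) measurable_id)).2 ?_
    filter_upwards [hRT] with x hx
    filter_upwards [hS.one, hS.mul (φ x)⁻¹ (φ x)] with y h1 h2
    rw [inv_mul_cancel, h1] at h2
    simp only [Function.comp_apply, rokhlinExtension, hx, ← h2, id]
  · refine (Measure.ae_prod_iff_ae_ae
      (measurableSet_eq_fun (hmp.measurable.comp hRm) measurable_id)).2 ?_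
    filter_upwards [hTR] with x hx
    filter_upwards [hS.one, hS.mul (φ (R x)) (φ (R x))⁻¹] with y h1 h2
    rw [mul_inv_cancel, h1] at h2
    simp only [Function.comp_apply, rokhlinExtension, hx, ← h2, id]

end Automorphism

/-- A measurable coefficient bounded by `1` together with a measurable `G`-valued shift. -/
structure TestPair (X G : Type*) [MeasurableSpace X] [MeasurableSpace G] where
  coeff : X → ℂ
  shift : X → G
  measurable_coeff : Measurable coeff
  measurable_shift : Measurable shift
  norm_coeff_le : ∀ x, ‖coeff x‖ ≤ 1

/-! ### Test functions and their spectral model -/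

section Correlation

variable {X Y G : Type*} [MeasurableSpace X] [MeasurableSpace Y]
  [CommGroup G] [MeasurableSpace G] {μ : Measure X} {ν : Measure Y}
  {T : X → X} {φ : X → G} {S : G → Y → Y} {h : Y → ℂ}

namespace TestPair

/-- The function `(x, y) ↦ a(x) h(S_{ψ(x)} y)`. -/
def fibreFun (i : TestPair X G) (S : G → Y → Y) (h : Y → ℂ) : X × Y → ℂ :=
  fun p => i.coeff p.1 * h (S (i.shift p.1) p.2)

theorem measurable_fibreFun (i : TestPair X G) (hS : IsMeasurableAction S ν) (hh : Measurable h) :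
    Measurable (i.fibreFun S h) :=
  (i.measurable_coeff.comp measurable_fst).mul (hh.comp (hS.measurable.comp
    ((i.measurable_shift.comp measurable_fst).prodMk measurable_snd)))

theorem memLp_fibreFun [IsProbabilityMeasure μ] [IsProbabilityMeasure ν]
    (i : TestPair X G) (hS : IsMeasurableAction S ν) (hh : Measurable h)
    {C : ℝ} (hC : ∀ y, ‖h y‖ ≤ C) : MemLp (i.fibreFun S h) 2 (μ.prod ν) := by
  refine MemLp.of_bound (i.measurable_fibreFun hS hh).aestronglyMeasurable (1 * C)
    (.of_forall fun p => ?_)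
  rw [fibreFun, norm_mul]
  exact mul_le_mul (i.norm_coeff_le _) (hC _) (norm_nonneg _) zero_le_one

variable [TopologicalSpace G] {τ : Measure (PontryaginDual G)}

/-- The function `(χ, x) ↦ a(x) χ(ψ(x))`. -/
noncomputable def dualFun (i : TestPair X G) : PontryaginDual G × X → ℂ :=
  fun p => i.coeff p.2 * p.1 (i.shift p.2)

/-- Invariance of ν under S_{g'} reduces the correlation to the Fourier transform of τ at g g'⁻¹. -/
theorem integral_conj_mul_eq (hS : IsMeasurableAction S ν) (hh : Measurable h)
    (hτ : IsSpectralMeasure S ν h τ) (g g' : G) :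
    ∫ y, h (S g y) * conj (h (S g' y)) ∂ν = ∫ χ : PontryaginDual G, (χ g : ℂ) * conj (χ g' : ℂ) ∂τ := by
  have h1 : ∀ χ : PontryaginDual G, (χ g : ℂ) * conj (χ g' : ℂ) = (χ (g * g'⁻¹) : ℂ) := fun χ => by
    rw [map_mul, map_inv, Circle.coe_mul, Circle.coe_inv_eq_conj]
  have hSm : ∀ g, Measurable (S g) := fun g => (hS.measurePreserving g).measurable
  simp_rw [h1]
  have h2 : ∫ y, h (S (g * g'⁻¹) y) * conj (h y) ∂ν =
      ∫ y, h (S (g * g'⁻¹) (S g' y)) * conj (h (S g' y)) ∂ν := by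
    conv_lhs => rw [← (hS.measurePreserving g').map_eq]
    exact integral_map (hSm g').aemeasurable ((hh.comp (hSm _)).mul
      (Complex.continuous_conj.measurable.comp hh)).aestronglyMeasurable
  rw [hτ.fourier, h2]
  refine integral_congr_ae ?_
  filter_upwards [hS.mul (g * g'⁻¹) g'] with y hy
  rw [← hy, inv_mul_cancel_right]

variable [IsTopologicalGroup G] [SecondCountableTopology G] [BorelSpace G]

/-- The pair by which the Rokhlin extension moves a test function. -/
def push (i : TestPair X G) (hT : Measurable T) (hφ : Measurable φ) : TestPair X G where
  coeff x := i.coeff (T x)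
  shift x := i.shift (T x) * φ x
  measurable_coeff := i.measurable_coeff.comp hT
  measurable_shift := (i.measurable_shift.comp hT).mul hφ
  norm_coeff_le x := i.norm_coeff_le (T x)

theorem weightedComp_dualFun (i : TestPair X G) (hT : Measurable T) (hφ : Measurable φ) :
    weightedComp (fun p : PontryaginDual G × X => p.1 (φ p.2)) (Prod.map id T) i.dualFun =
      (i.push hT hφ).dualFun := by
  ext p
  simp only [weightedComp, dualFun, push, Prod.map_fst, Prod.map_snd, id, map_mul, Circle.coe_mul]
  ring

theorem weightedComp_fibreFun [SFinite μ] [SFinite ν] (i : TestPair X G)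
    (hT : MeasurePreserving T μ μ) (hφ : Measurable φ)
    (hS : IsMeasurableAction S ν) (hh : Measurable h) :
    weightedComp (fun _ => 1) (rokhlinExtension T φ S) (i.fibreFun S h) =ᵐ[μ.prod ν]
      (i.push hT.measurable hφ).fibreFun S h := by
  have hmp := measurePreserving_rokhlinExtension hT hφ hS
  have hm : Measurable (weightedComp (fun _ => 1) (rokhlinExtension T φ S) (i.fibreFun S h)) :=
    measurable_const.mul ((i.measurable_fibreFun hS hh).comp hmp.measurable)
  refine (Measure.ae_prod_iff_ae_ae (measurableSet_eq_fun hm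
    ((i.push hT.measurable hφ).measurable_fibreFun hS hh))).2 (.of_forall fun x => ?_)
  filter_upwards [hS.mul (i.shift (T x)) (φ x)] with y hy
  simp [weightedComp, fibreFun, push, rokhlinExtension, hy]

variable [T2Space G] [LocallyCompactSpace G]

theorem measurable_dualFun (i : TestPair X G) : Measurable i.dualFun :=
  (i.measurable_coeff.comp measurable_snd).mul (measurable_dual_eval.comp
    (measurable_fst.prodMk (i.measurable_shift.comp measurable_snd)))

theorem memLp_dualFun (i : TestPair X G) [IsProbabilityMeasure μ] [IsFiniteMeasure τ] :
    MemLp i.dualFun 2 (τ.prod μ) := by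
  refine MemLp.of_bound i.measurable_dualFun.aestronglyMeasurable 1 (.of_forall fun p => ?_)
  rw [dualFun, norm_mul, Circle.norm_coe, mul_one]
  exact i.norm_coeff_le _

/-- By Fubini both sides can be compared at fixed x, where the coefficients factor out and
`integral_conj_mul_eq` applies. This is the Gram hypothesis of `exists_intertwiner`. -/
theorem inner_fibreFun_eq_inner_dualFun [IsProbabilityMeasure μ] [IsProbabilityMeasure ν]
    (hS : IsMeasurableAction S ν) (hh : Measurable h)
    {C : ℝ} (hC : ∀ y, ‖h y‖ ≤ C) [IsFiniteMeasure τ] (hτ : IsSpectralMeasure S ν h τ)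
    (i j : TestPair X G) :
    inner ℂ ((i.memLp_fibreFun (μ := μ) hS hh hC).toLp _) ((j.memLp_fibreFun hS hh hC).toLp _) =
      inner ℂ ((i.memLp_dualFun (μ := μ) (τ := τ)).toLp _) (j.memLp_dualFun.toLp _) := by
  have hL : inner ℂ ((i.memLp_fibreFun (μ := μ) hS hh hC).toLp _)
      ((j.memLp_fibreFun hS hh hC).toLp _) =
      ∫ p, j.fibreFun S h p * conj (i.fibreFun S h p) ∂(μ.prod ν) := by
    rw [L2.inner_def]
    refine integral_congr_ae ?_
    filter_upwards [(i.memLp_fibreFun (μ := μ) hS hh hC).coeFn_toLp,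
      (j.memLp_fibreFun (μ := μ) hS hh hC).coeFn_toLp] with p hp hp'
    rw [hp, hp', RCLike.inner_apply]
  have hR : inner ℂ ((i.memLp_dualFun (μ := μ) (τ := τ)).toLp _) (j.memLp_dualFun.toLp _) =
      ∫ p, j.dualFun p * conj (i.dualFun p) ∂(τ.prod μ) := by
    rw [L2.inner_def]
    refine integral_congr_ae ?_
    filter_upwards [(i.memLp_dualFun (μ := μ) (τ := τ)).coeFn_toLp,
      (j.memLp_dualFun (μ := μ) (τ := τ)).coeFn_toLp] with p hp hp'
    rw [hp, hp', RCLike.inner_apply]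
  have hiL : Integrable (fun p => j.fibreFun S h p * conj (i.fibreFun S h p)) (μ.prod ν) :=
    (j.memLp_fibreFun hS hh hC).integrable_mul (i.memLp_fibreFun hS hh hC).star
  have hiR : Integrable (fun p => j.dualFun p * conj (i.dualFun p)) (τ.prod μ) :=
    j.memLp_dualFun.integrable_mul i.memLp_dualFun.star
  rw [hL, hR, integral_prod _ hiL, integral_prod_symm _ hiR]
  refine integral_congr_ae (.of_forall fun x => ?_)
  have e1 : ∀ y, j.fibreFun S h (x, y) * conj (i.fibreFun S h (x, y)) =
      (j.coeff x * conj (i.coeff x)) * (h (S (j.shift x) y) * conj (h (S (i.shift x) y))) :=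
    fun y => by simp only [fibreFun, map_mul]; ring
  have e2 : ∀ χ : PontryaginDual G, j.dualFun (χ, x) * conj (i.dualFun (χ, x)) =
      (j.coeff x * conj (i.coeff x)) * ((χ (j.shift x) : ℂ) * conj (χ (i.shift x) : ℂ)) :=
    fun y => by simp only [dualFun, map_mul]; ring
  simp only [e1, e2, integral_const_mul]
  rw [integral_conj_mul_eq hS hh hτ]

end TestPair

variable [TopologicalSpace G] [IsTopologicalGroup G] [T2Space G] [LocallyCompactSpace G]
  [SecondCountableTopology G] [BorelSpace G] {τ : Measure (PontryaginDual G)}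
  [IsProbabilityMeasure μ] [IsProbabilityMeasure ν]

/-- A recurrent function of the Rokhlin extension is orthogonal to every test function whose fibre
part has a spectral measure that does not charge the quasi-coboundary group. -/
theorem MildlyMixing.inner_fibreFun_eq_zero (hT : MildlyMixing T μ) (hφ : Measurable φ)
    (hS : IsMeasurableAction S ν) (hh : Measurable h) {C : ℝ} (hC : ∀ y, ‖h y‖ ≤ C)
    (hτ : IsSpectralMeasure S ν h τ) (hτ0 : τ (quasiCoboundaryGroup T μ φ) = 0)
    {q : ℕ → ℕ} (hq : Tendsto q atTop atTop) {f : X × Y → ℂ} (hf : MemLp f 2 (μ.prod ν))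
    (hlim : Tendsto (fun n => eLpNorm
      (fun p => f ((rokhlinExtension T φ S)^[q n] p) - f p) 2 (μ.prod ν)) atTop (𝓝 0))
    (i : TestPair X G) :
    ∫ p, f p * conj (i.fibreFun S h p) ∂(μ.prod ν) = 0 := by
  have := hτ.finite
  have hTmp := hT.isAutomorphism.measurePreserving
  have hmp := measurePreserving_rokhlinExtension hTmp hφ hS
  have hmp' : MeasurePreserving (Prod.map id T : PontryaginDual G × X → _) (τ.prod μ) (τ.prod μ) :=
    (MeasurePreserving.id τ).prod hTmp
  have h1 : Measurable fun _ : X × Y => ((1 : Circle) : ℂ) := measurable_const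
  have hφm : Measurable fun p : PontryaginDual G × X => (p.1 (φ p.2) : ℂ) :=
    measurable_dual_eval.comp (measurable_fst.prodMk (hφ.comp measurable_snd))
  let U := weightedCompL2 (a := fun _ => 1) h1 hmp
  let M := weightedCompL2 (a := fun p : PontryaginDual G × X => p.1 (φ p.2)) hφm hmp'
  obtain ⟨V, hVU, hV0⟩ := exists_intertwiner
    (v := fun i : TestPair X G => (i.memLp_fibreFun (μ := μ) hS hh hC).toLp _)
    (w := fun i : TestPair X G => (i.memLp_dualFun (μ := μ) (τ := τ)).toLp _)
    (TestPair.inner_fibreFun_eq_inner_dualFun hS hh hC hτ) U M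
    (fun i => ⟨i.push hTmp.measurable hφ,
      weightedCompL2_toLp h1 hmp _ _ (i.weightedComp_fibreFun hTmp hφ hS hh),
      weightedCompL2_toLp hφm hmp' _ _
        (EventuallyEq.of_eq (i.weightedComp_dualFun hTmp.measurable hφ))⟩)
    (fun i => by
      obtain ⟨R, hR, hRT, -⟩ := hT.isAutomorphism.exists_inverse
      -- The pair that `push` sends back to i almost everywhere: move along R and divide the shift
      -- by φ(R x).
      let j : TestPair X G :=
        { coeff := fun x => i.coeff (R x)
          shift := fun x => i.shift (R x) * (φ (R x))⁻¹
          measurable_coeff := i.measurable_coeff.comp hR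
          measurable_shift := (i.measurable_shift.comp hR).mul (hφ.comp hR).inv
          norm_coeff_le := fun x => i.norm_coeff_le (R x) }
      refine ⟨j, weightedCompL2_toLp h1 hmp _ _
        ((j.weightedComp_fibreFun hTmp hφ hS hh).trans ?_)⟩
      filter_upwards [Measure.quasiMeasurePreserving_fst.ae hRT] with p hp
      simp [TestPair.fibreFun, TestPair.push, j, hp])
  have hVUn : ∀ n g, V (U^[n] g) = M^[n] (V g) := fun n g => by
    induction n with
    | zero => rfl
    | succ n ih => rw [Function.iterate_succ_apply', Function.iterate_succ_apply', hVU, ih]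
  have hUlim : Tendsto (fun n => U^[q n] (hf.toLp f)) atTop (𝓝 (hf.toLp f)) := by
    rw [Lp.tendsto_Lp_iff_tendsto_eLpNorm']
    refine hlim.congr fun n => eLpNorm_congr_ae ?_
    have hc := (hmp.iterate (q n)).quasiMeasurePreserving.ae hf.coeFn_toLp
    filter_upwards [hf.coeFn_toLp, hc, coeFn_iterate_weightedCompL2 h1 hmp (hf.toLp f) (q n)]
      with p hp hp' hp''
    rw [Pi.sub_apply, hp, hp'', iterate_weightedComp_one, Function.comp_apply, hp']
  set F : Lp ℂ 2 (τ.prod μ) := V (hf.toLp f) with hF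
  have hMlim : Tendsto (fun n => M^[q n] F) atTop (𝓝 F) := by
    simp only [hF, ← hVUn]
    exact (V.continuous.tendsto _).comp hUlim
  -- Pointwise convergence requires a subsequence, which is harmless since `q ∘ ns` still tends to
  -- infinity.
  obtain ⟨ns, hns, hae⟩ := (tendstoInMeasure_of_tendsto_Lp hMlim).exists_seq_tendsto_ae
  have hFm : Measurable (F : PontryaginDual G × X → ℂ) := (Lp.stronglyMeasurable F).measurable
  have hae' : ∀ᵐ χ ∂τ, ∀ᵐ x ∂μ, Tendsto (fun n =>
      (weightedComp (fun x => χ (φ x)) T)^[q (ns n)] (fun x => F (χ, x)) x) atTop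
      (𝓝 (F (χ, x))) := by
    refine Measure.ae_ae_of_ae_prod (p := fun p : PontryaginDual G × X => Tendsto (fun n =>
      (weightedComp (fun x => p.1 (φ x)) T)^[q (ns n)] (fun x => F (p.1, x)) p.2) atTop
      (𝓝 (F p))) ?_
    filter_upwards [hae, ae_all_iff.2 fun n => coeFn_iterate_weightedCompL2 hφm hmp' F (q (ns n))]
      with p hp hp'
    refine hp.congr fun n => ?_
    rw [← iterate_weightedComp_prod T (fun p : PontryaginDual G × X => p.1 (φ p.2)), ← hp']
  have hF0 : F = 0 := by
    refine Lp.ext (EventuallyEq.trans ?_ (Lp.coeFn_zero _ _ _).symm)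
    refine (Measure.ae_prod_iff_ae_ae (measurableSet_eq_fun hFm measurable_zero)).2 ?_
    -- Nullity is that of the outer measure, so the quasi-coboundary group need not be shown
    -- measurable.
    filter_upwards [hae', measure_eq_zero_iff_ae_notMem.1 hτ0] with χ hχ hχ'
    by_contra hne
    exact hχ' (hT.exists_quasiCoboundary (a := fun x => χ (φ x)) (hq.comp hns.tendsto_atTop)
      (hφm.comp measurable_prodMk_left) (hFm.comp measurable_prodMk_left) hχ hne)
  have hz := hV0 _ hF0 i
  rw [L2.inner_def] at hz
  rw [← hz]
  refine integral_congr_ae ?_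
  filter_upwards [hf.coeFn_toLp, (i.memLp_fibreFun (μ := μ) hS hh hC).coeFn_toLp] with p hp hp'
  rw [hp, hp', RCLike.inner_apply]

end Correlation

/-! ### Functions determined by integrals over rectangles -/

section Rectangles

variable {X Y : Type*} [MeasurableSpace X] [MeasurableSpace Y]

theorem ae_eq_zero_of_forall_setIntegral_prod_eq_zero {ρ : Measure (X × Y)} {f : X × Y → ℂ}
    (hf : Integrable f ρ)
    (h : ∀ B D, MeasurableSet B → MeasurableSet D → ∫ p in B ×ˢ D, f p ∂ρ = 0) :
    f =ᵐ[ρ] 0 := by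
  have huniv : ∫ p, f p ∂ρ = 0 := by
    simpa using h Set.univ Set.univ MeasurableSet.univ MeasurableSet.univ
  have key : ∀ s, MeasurableSet s → ∫ p in s, f p ∂ρ = 0 := by
    intro s hs
    induction s, hs using MeasurableSpace.induction_on_inter generateFrom_prod.symm
      isPiSystem_prod with
    | empty => simp
    | basic t ht =>
      obtain ⟨B, hB, D, hD, rfl⟩ := ht
      exact h B D hB hD
    | compl t ht ih =>
      have h2 := integral_add_compl ht hf
      rwa [ih, huniv, zero_add] at h2
    | iUnion u hd hm ih =>
      rw [integral_iUnion hm hd hf.integrableOn]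
      simp [ih]
  exact hf.ae_eq_zero_of_forall_setIntegral_eq_zero fun s hs _ => key s hs

end Rectangles

/-! ### Recurrence of fibre integrals -/

section MarginalRecurrence

variable {X Y G : Type*} [MeasurableSpace X] [MeasurableSpace Y] [CommGroup G] [MeasurableSpace G]
  {μ : Measure X} {ν : Measure Y} {T : X → X} {φ : X → G} {S : G → Y → Y}

/-- Each fibre map preserves ν, so integrating over y erases the cocycle. -/
theorem integral_iterate_rokhlinExtension [SFinite μ] [SFinite ν]
    (hT : MeasurePreserving T μ μ) (hφ : Measurable φ)
    (hS : IsMeasurableAction S ν) {f : X × Y → ℂ} (hf : Measurable f) (n : ℕ) (x : X) :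
    ∫ y, f ((rokhlinExtension T φ S)^[n] (x, y)) ∂ν = ∫ y, f (T^[n] x, y) ∂ν := by
  have hR := (measurePreserving_rokhlinExtension hT hφ hS).measurable
  induction n generalizing x with
  | zero => rfl
  | succ n ih =>
    simp only [Function.iterate_succ_apply]
    rw [← ih]
    conv_rhs => rw [← (hS.measurePreserving (φ x)).map_eq]
    have hm : Measurable fun y => f ((rokhlinExtension T φ S)^[n] (T x, y)) :=
      (hf.comp (hR.iterate n)).comp measurable_prodMk_left
    exact (integral_map (hS.measurePreserving (φ x)).measurable.aemeasurable
      hm.aestronglyMeasurable).symm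

/-- Fibre integration contracts L¹ norms and intertwines the extension with T, so L² recurrence of f
gives L¹ recurrence of its fibre integral. -/
theorem MildlyMixing.ae_integral_eq_const [IsProbabilityMeasure μ] [IsProbabilityMeasure ν]
    (hT : MildlyMixing T μ) (hφ : Measurable φ) (hS : IsMeasurableAction S ν)
    {q : ℕ → ℕ} (hq : Tendsto q atTop atTop) {f : X × Y → ℂ} (hfm : Measurable f) {C : ℝ}
    (hC : ∀ p, ‖f p‖ ≤ C)
    (hlim : Tendsto (fun n => eLpNorm
      (fun p => f ((rokhlinExtension T φ S)^[q n] p) - f p) 2 (μ.prod ν)) atTop (𝓝 0)) :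
    ∃ c, ∀ᵐ x ∂μ, ∫ y, f (x, y) ∂ν = c := by
  have hTmp := hT.isAutomorphism.measurePreserving
  have hR := (measurePreserving_rokhlinExtension hTmp hφ hS).measurable
  have hPm : Measurable fun x => ∫ y, f (x, y) ∂ν :=
    hfm.stronglyMeasurable.integral_prod_right'.measurable
  refine hT.ae_eq_const_of_tendstoInMeasure hq hPm
    (tendstoInMeasure_of_tendsto_eLpNorm (p := 1) one_ne_zero
      (fun n => (hPm.comp (hTmp.measurable.iterate _)).aestronglyMeasurable)
      hPm.aestronglyMeasurable ?_)
  refine tendsto_of_tendsto_of_tendsto_of_le_of_le tendsto_const_nhds hlim (fun _ => zero_le)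
    fun n => ?_
  have hdm : Measurable fun p => f ((rokhlinExtension T φ S)^[q n] p) - f p :=
    (hfm.comp (hR.iterate _)).sub hfm
  refine le_trans ?_ (eLpNorm_le_eLpNorm_of_exponent_le (p := 1) one_le_two
    hdm.aestronglyMeasurable)
  rw [eLpNorm_one_eq_lintegral_enorm, eLpNorm_one_eq_lintegral_enorm,
    lintegral_prod _ hdm.enorm.aemeasurable]
  refine lintegral_mono fun x => ?_
  have hi : ∀ g : Y → X × Y, Measurable g → Integrable (fun y => f (g y)) ν := fun g hg =>
    Integrable.of_bound (hfm.comp hg).aestronglyMeasurable C (.of_forall fun y => hC _)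
  rw [Pi.sub_apply, ← integral_iterate_rokhlinExtension hTmp hφ hS hfm,
    ← integral_sub (hi (fun y => (rokhlinExtension T φ S)^[q n] (x, y))
      ((hR.iterate _).comp measurable_prodMk_left)) (hi _ measurable_prodMk_left)]
  exact enorm_integral_le_lintegral_enorm _

end MarginalRecurrence

/-! ### From vanishing functions to trivial factors -/

section TrivialFactor

/-- A rigid factor is trivial if the bounded recurrent functions of mean zero vanish. -/
theorem IsRigidFactor.isTrivialMod {Z : Type*} {𝒜 : MeasurableSpace Z} [mZ : MeasurableSpace Z]
    {R : Z → Z} {ρ : Measure Z} [IsProbabilityMeasure ρ] (h𝒜 : IsRigidFactor 𝒜 R ρ)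
    (h : ∀ (q : ℕ → ℕ) (f : Z → ℂ) (C : ℝ), Tendsto q atTop atTop → Measurable f →
      (∀ p, ‖f p‖ ≤ C) → ∫ p, f p ∂ρ = 0 →
      Tendsto (fun n => eLpNorm (fun p => f (R^[q n] p) - f p) 2 ρ) atTop (𝓝 0) → f =ᵐ[ρ] 0) :
    IsTrivialMod 𝒜 ρ := by
  intro A hA
  obtain ⟨hfac, q, hq, hrig⟩ := h𝒜
  have hAm : MeasurableSet[mZ] A := hfac.le A hA
  set m := ρ.real A
  let f : Z → ℂ := fun p => A.indicator (fun _ => (1 : ℂ)) p - m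
  have hfs : StronglyMeasurable[𝒜] f :=
    (stronglyMeasurable_const.indicator hA).sub stronglyMeasurable_const
  have hfm : Measurable[mZ] f := (measurable_const.indicator hAm).sub measurable_const
  have hf2 : ∀ p, ‖f p‖ ≤ 1 + ‖(m : ℂ)‖ := fun p =>
    (norm_sub_le _ _).trans (add_le_add_left
      ((norm_indicator_le_norm_self _ _).trans (by simp)) _)
  have hmean : ∫ p, f p ∂ρ = 0 := by
    rw [integral_sub ((integrable_const _).indicator hAm) (integrable_const _),
      integral_indicator_const _ hAm]
    simp [m]
  have hzero := h q f _ hq hfm hf2 hmean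
    (hrig f hfs (MemLp.of_bound hfm.aestronglyMeasurable _ (.of_forall hf2)))
  -- The centred indicator equals 1 - m on A and -m off A, and vanishes almost everywhere: m = 1
  -- excludes the complement, m ≠ 1 excludes A.
  by_cases hm : (m : ℂ) = 1
  · right
    change ∀ᵐ p ∂ρ, p ∈ A
    filter_upwards [hzero] with p hp
    by_contra hpA
    simp [f, hm, hpA] at hp
  · left
    rw [measure_eq_zero_iff_ae_notMem]
    filter_upwards [hzero] with p hp hpA
    simp only [f, Set.indicator_of_mem hpA, Pi.zero_apply, sub_eq_zero] at hp
    exact hm hp.symm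

end TrivialFactor

/-! ### Vanishing of recurrent functions and the theorem -/

section Vanishing

variable {X Y G : Type*} [MeasurableSpace X] [MeasurableSpace Y]
  [CommGroup G] [TopologicalSpace G] [IsTopologicalGroup G] [T2Space G] [LocallyCompactSpace G]
  [SecondCountableTopology G] [MeasurableSpace G] [BorelSpace G]
  {μ : Measure X} {ν : Measure Y} [IsProbabilityMeasure μ] [IsProbabilityMeasure ν]
  {T : X → X} {φ : X → G} {S : G → Y → Y} {σ : Measure (PontryaginDual G)}

/-- A bounded recurrent function of mean zero of the Rokhlin extension vanishes. -/
theorem MildlyMixing.ae_eq_zero_of_recurrent (hT : MildlyMixing T μ) (hφ : Measurable φ)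
    (hS : IsMeasurableAction S ν) (hσ : IsMaximalSpectralType S ν σ)
    (hσ0 : σ (quasiCoboundaryGroup T μ φ) = 0)
    {q : ℕ → ℕ} (hq : Tendsto q atTop atTop) {f : X × Y → ℂ} (hfm : Measurable f) {C : ℝ}
    (hC : ∀ p, ‖f p‖ ≤ C) (hmean : ∫ p, f p ∂(μ.prod ν) = 0)
    (hlim : Tendsto (fun n => eLpNorm
      (fun p => f ((rokhlinExtension T φ S)^[q n] p) - f p) 2 (μ.prod ν)) atTop (𝓝 0)) :
    f =ᵐ[μ.prod ν] 0 := by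
  have hfi : Integrable f (μ.prod ν) :=
    Integrable.of_bound hfm.aestronglyMeasurable C (.of_forall hC)
  have hmarg : ∀ᵐ x ∂μ, ∫ y, f (x, y) ∂ν = 0 := by
    obtain ⟨c, hc⟩ := hT.ae_integral_eq_const hφ hS hq hfm hC hlim
    rw [integral_prod _ hfi, integral_congr_ae hc] at hmean
    simp only [integral_const, probReal_univ, one_smul] at hmean
    rwa [hmean] at hc
  refine ae_eq_zero_of_forall_setIntegral_prod_eq_zero hfi fun B D hB hD => ?_
  have hBuniv : ∫ p in B ×ˢ Set.univ, f p ∂(μ.prod ν) = 0 := by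
    rw [setIntegral_prod _ hfi.integrableOn]
    simp only [Measure.restrict_univ]
    rw [integral_congr_ae (ae_restrict_of_ae hmarg), integral_zero]
  -- Centring puts h in L²₀; the subtracted constant contributes only the integral of f over B × Y,
  -- which is zero by `hBuniv`.
  let h : Y → ℂ := fun y => D.indicator (fun _ => (1 : ℂ)) y - ν.real D
  have hhm : Measurable h := (measurable_const.indicator hD).sub measurable_const
  have hh2 : ∀ y, ‖h y‖ ≤ 2 := fun y => by
    refine (norm_sub_le _ _).trans ?_
    have h1 : ‖D.indicator (fun _ => (1 : ℂ)) y‖ ≤ 1 :=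
      (norm_indicator_le_norm_self _ _).trans (by simp)
    have h2 : ‖(ν.real D : ℂ)‖ ≤ 1 := by
      rw [Complex.norm_real, Real.norm_of_nonneg measureReal_nonneg]
      exact measureReal_le_one
    linarith
  have hmem : MemL2Zero ν h := by
    refine ⟨MemLp.of_bound hhm.aestronglyMeasurable 2 (.of_forall hh2), ?_⟩
    rw [integral_sub ((integrable_const _).indicator hD) (integrable_const _),
      integral_indicator_const _ hD]
    simp
  obtain ⟨τ, hτ, hτσ⟩ := hσ.dominates h hmem
  let i : TestPair X G :=
    { coeff := B.indicator fun _ => 1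
      shift := fun _ => 1
      measurable_coeff := measurable_const.indicator hB
      measurable_shift := measurable_const
      norm_coeff_le := fun x => (norm_indicator_le_norm_self _ _).trans (by simp) }
  have hi := hT.inner_fibreFun_eq_zero hφ hS hhm hh2 hτ (hτσ hσ0) hq
    (MemLp.of_bound hfm.aestronglyMeasurable C (.of_forall hC)) hlim i
  have hae : (fun p => f p * conj (i.fibreFun S h p)) =ᵐ[μ.prod ν] fun p =>
      (B ×ˢ D).indicator f p - (ν.real D : ℂ) * (B ×ˢ Set.univ).indicator f p := by
    filter_upwards [Measure.quasiMeasurePreserving_snd.ae hS.one] with p hp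
    by_cases hpB : p.1 ∈ B <;> by_cases hpD : p.2 ∈ D <;>
      simp [TestPair.fibreFun, i, h, hp, Set.indicator, hpB, hpD] <;> ring
  rw [integral_congr_ae hae, integral_sub (hfi.indicator (hB.prod hD))
    ((hfi.indicator (hB.prod MeasurableSet.univ)).const_mul _), integral_const_mul,
    integral_indicator (hB.prod hD), integral_indicator (hB.prod MeasurableSet.univ), hBuniv,
    mul_zero, sub_zero] at hi
  exact hi

end Vanishing

end RokhlinExtension

theorem mainTheorem4
    {X Y G : Type*}
    [MeasurableSpace X] [StandardBorelSpace X]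
    [MeasurableSpace Y] [StandardBorelSpace Y]
    [CommGroup G] [TopologicalSpace G] [IsTopologicalGroup G] [T2Space G]
    [LocallyCompactSpace G] [SecondCountableTopology G] [MeasurableSpace G] [BorelSpace G]
    (μ : MeasureTheory.Measure X) [MeasureTheory.IsProbabilityMeasure μ]
    (ν : MeasureTheory.Measure Y) [MeasureTheory.IsProbabilityMeasure ν]
    (T : X → X) (φ : X → G) (S : G → Y → Y) (σ : MeasureTheory.Measure (PontryaginDual G))
    (hφ : Measurable φ)
    (hS : RokhlinExtension.IsMeasurableAction S ν)
    (hσ : RokhlinExtension.IsMaximalSpectralType S ν σ)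
    (hT : RokhlinExtension.MildlyMixing T μ)
    (h_zero : σ (RokhlinExtension.quasiCoboundaryGroup T μ φ) = 0) :
    RokhlinExtension.MildlyMixing (RokhlinExtension.rokhlinExtension T φ S) (μ.prod ν) :=
  ⟨RokhlinExtension.isAutomorphism_rokhlinExtension hT.isAutomorphism hφ hS,
    fun 𝒜 h𝒜 => @RokhlinExtension.IsRigidFactor.isTrivialMod (X × Y) 𝒜 Prod.instMeasurableSpace
      _ _ _ h𝒜 fun _ _ _ hq hf hC hmean hlim =>
      hT.ae_eq_zero_of_recurrent hφ hS hσ h_zero hq hf hC hmean hlim⟩
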